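/- Conventions. An inverse monoid is a monoid $M$ in which every $a$ has a unique inverse, i.e. a unique $b$ with $a=aba$ and $b=bab$. Its natural partial order is given by $a\le b$ if and only if $a=eb$ for some idempotent $e\in M$, and $\sigma$ denotes its least group congruence. $M$ is finite-above if $\{n\in M: n\ge m\}$ is finite for every $m\in M$; $E$-unitary if every element above an idempotent is idempotent; $F$-inverse if every $\sigma$-class has a greatest element. A group variety is the class of all groups satisfying a given set of laws; it is non-trivial if it contains a non-trivial group. An inverse monoid $M$ has an $F$-inverse cover via a group variety $\mathbf U$ if there are an $F$-inverse monoid $F$ and a surjective homomorphism $\varphi\colon F\to M$ that is injective on idempotents, such that the kernel of the induced group homomorphism $F/\sigma\to M/\sigma$ belongs to $\mathbf U$. Statement. Let $S$ be a non-empty (meet-)semilattice which has no greatest element and in which, for every $s\in S$, the set of elements greater than $s$ is finite. Let $G$ be a group acting on $S$ on the left by automorphisms, $(g,t)\mapsto {}^{g}t$. Let $S\rtimes G$ be the set $S\times G$ with the multiplication $(s,g)(t,h)=(s\cdot{}^{g}t,\,gh)$, where $\cdot$ denotes the meet operation, and let $M=(S\rtimes G)^1$ be obtained from $S\rtimes G$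 by adjoining an identity element $1$. Then: 1. $M$ is a finite-above $E$-unitary inverse monoid; 2. if $G$ is non-trivial, then $M$ is not $F$-inverse; 3. $M$ has an $F$-inverse cover via every non-trivial group variety. -/

import Mathlib

universe u v w

/-! ### Inverse monoids, natural partial order, least group congruence -/

/-- A monoid in which every element `a` has a unique inverse: a unique `b` such that
`a = a b a` and `b = b a b`. -/
class IsInverseMonoid (M : Type*) [Monoid M] : Prop where
  existsUnique_inverse : ∀ a : M, ∃! b : M, a = a * b * a ∧ b = b * a * b

/-- The natural partial order of an inverse monoid: `a ≤ b` iff `a = e b` for some idempotent `e`. -/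
def NaturalLE {M : Type*} [Monoid M] (a b : M) : Prop :=
  ∃ e : M, IsIdempotentElem e ∧ a = e * b

/-- A congruence is a group congruence if its quotient monoid is a group. -/
def IsGroupCon {M : Type*} [Monoid M] (c : Con M) : Prop :=
  ∀ x : c.Quotient, IsUnit x

/-- The least group congruence `σ`: the intersection of all group congruences
(which is itself a group congruence on an inverse monoid, see `isGroupCon_leastGroupCon`). -/
def leastGroupCon (M : Type*) [Monoid M] : Con M :=
  sInf {c : Con M | IsGroupCon c}

theorem IsGroupCon.rel_one {M : Type*} [Monoid M] {c : Con M} (hc : IsGroupCon c) {e : M}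
    (he : IsIdempotentElem e) : c e 1 := by
  have h : (e : c.Quotient) * (e : c.Quotient) = (e : c.Quotient) * 1 := by
    rw [mul_one, ← Con.coe_mul, he.eq]
  have h2 := (hc (e : c.Quotient)).mul_left_cancel h
  rw [← Con.coe_one] at h2
  exact c.eq.1 h2

theorem isGroupCon_of_rel_one {M : Type*} [Monoid M] [IsInverseMonoid M] {c : Con M}
    (h : ∀ e : M, IsIdempotentElem e → c e 1) : IsGroupCon c := by
  intro x
  induction x using Con.induction_on with
  | H a =>
    obtain ⟨b, ⟨hb, -⟩, -⟩ := IsInverseMonoid.existsUnique_inverse a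
    have h1 : IsIdempotentElem (a * b) := by
      change a * b * (a * b) = a * b
      rw [← mul_assoc, ← hb]
    have h2 : IsIdempotentElem (b * a) := by
      change b * a * (b * a) = b * a
      rw [mul_assoc, ← mul_assoc a, ← hb]
    exact ⟨⟨(a : c.Quotient), (b : c.Quotient),
      by rw [← Con.coe_mul, ← Con.coe_one]; exact c.eq.2 (h _ h1),
      by rw [← Con.coe_mul, ← Con.coe_one]; exact c.eq.2 (h _ h2)⟩, rfl⟩

theorem leastGroupCon_rel_one {M : Type*} [Monoid M] {e : M} (he : IsIdempotentElem e) :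
    leastGroupCon M e 1 :=
  fun _ hc => IsGroupCon.rel_one hc he

theorem isGroupCon_leastGroupCon (M : Type*) [Monoid M] [IsInverseMonoid M] :
    IsGroupCon (leastGroupCon M) :=
  isGroupCon_of_rel_one fun _ he => leastGroupCon_rel_one he

/-- The quotient `M/σ` by the least group congruence. -/
def GroupImage (M : Type*) [Monoid M] : Type _ := (leastGroupCon M).Quotient

instance GroupImage.instMonoid (M : Type*) [Monoid M] : Monoid (GroupImage M) :=
  inferInstanceAs (Monoid (leastGroupCon M).Quotient)

noncomputable instance GroupImage.instGroup (M : Type*) [Monoid M] [IsInverseMonoid M] :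
    Group (GroupImage M) where
  __ := GroupImage.instMonoid M
  inv x := ((isGroupCon_leastGroupCon M x).unit⁻¹ : (GroupImage M)ˣ)
  inv_mul_cancel x := (isGroupCon_leastGroupCon M x).val_inv_mul

/-- The natural homomorphism `M → M/σ`. -/
def GroupImage.mk (M : Type*) [Monoid M] : M →* GroupImage M := (leastGroupCon M).mk'

theorem leastGroupCon_le_ker {F M : Type*} [Monoid F] [IsInverseMonoid F] [Monoid M]
    (f : F →* M) : leastGroupCon F ≤ Con.ker ((GroupImage.mk M).comp f) := by
  have h : IsGroupCon (Con.ker ((GroupImage.mk M).comp f)) := by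
    refine isGroupCon_of_rel_one fun e he => ?_
    rw [Con.ker_rel, map_one]
    exact (leastGroupCon M).eq.2 (leastGroupCon_rel_one (he.map f))
  exact sInf_le h

/-- The homomorphism `F/σ → M/σ` induced by a homomorphism `f : F → M`. -/
def GroupImage.map {F M : Type*} [Monoid F] [IsInverseMonoid F] [Monoid M] (f : F →* M) :
    GroupImage F →* GroupImage M :=
  (leastGroupCon F).lift ((GroupImage.mk M).comp f) (leastGroupCon_le_ker f)

/-! ### Properties of inverse monoids -/

/-- Every element has only finitely many elements above it in the natural partial order. -/
def IsFiniteAbove (M : Type*) [Monoid M] : Prop :=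
  ∀ m : M, {n : M | NaturalLE m n}.Finite

/-- Every element above an idempotent is idempotent. -/
def IsEUnitary (M : Type*) [Monoid M] : Prop :=
  ∀ e m : M, IsIdempotentElem e → NaturalLE e m → IsIdempotentElem m

/-- An inverse monoid each of whose `σ`-classes has a greatest element
with respect to the natural partial order. -/
def IsFInverse (M : Type*) [Monoid M] : Prop :=
  IsInverseMonoid M ∧
    ∀ a : M, ∃ m : M, leastGroupCon M m a ∧ ∀ b : M, leastGroupCon M b a → NaturalLE b m

/-! ### Group varieties -/

/-- A group variety, given by a set of laws `w = 1`, where `w` is a word in countably many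
variables. -/
structure GroupVariety where
  laws : Set (FreeGroup ℕ)

/-- The group `H` belongs to the variety: it satisfies all the laws. -/
def GroupVariety.Mem (U : GroupVariety) (H : Type*) [Group H] : Prop :=
  ∀ w ∈ U.laws, ∀ v : ℕ → H, FreeGroup.lift v w = 1

/-- The variety contains a non-trivial group. -/
def GroupVariety.IsNontrivial (U : GroupVariety) : Prop :=
  ∃ (H : Type w) (_ : Group H), U.Mem H ∧ Nontrivial H

/-! ### `F`-inverse covers -/

/-- `M` has an `F`-inverse cover via the variety `U`: there are an `F`-inverse monoid `F` and a
surjective idempotent-separating homomorphism `f : F → M` such that the kernel of the induced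
homomorphism `F/σ → M/σ` belongs to `U`. -/
def HasFInverseCoverVia (M : Type w) [Monoid M] (U : GroupVariety) : Prop :=
  ∃ (F : Type w) (_ : Monoid F) (_ : IsInverseMonoid F) (f : F →* M),
    IsFInverse F ∧ Function.Surjective f ∧ Set.InjOn f {e : F | IsIdempotentElem e} ∧
      U.Mem (GroupImage.map f).ker

/-! ### Semidirect products of semilattices by groups -/

/-- The semidirect product of a (meet-)semilattice `S` by a group `G` acting on `S` on the left by
automorphisms `φ g`, with multiplication `(s, g)(t, h) = (s ⊓ φ g t, g h)`. -/
@[ext]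
structure SemilatticeSemidirect (S G : Type*) [SemilatticeInf S] [Group G]
    (φ : G →* (S ≃o S)) where
  left : S
  right : G

instance SemilatticeSemidirect.instSemigroup {S G : Type*} [SemilatticeInf S] [Group G]
    (φ : G →* (S ≃o S)) : Semigroup (SemilatticeSemidirect S G φ) where
  mul a b := ⟨a.left ⊓ φ a.right b.left, a.right * b.right⟩
  mul_assoc a b c := by
    apply SemilatticeSemidirect.ext
    · change a.left ⊓ φ a.right b.left ⊓ φ (a.right * b.right) c.left =
        a.left ⊓ φ a.right (b.left ⊓ φ b.right c.left)
      rw [map_mul, RelIso.mul_apply, map_inf, inf_assoc]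
    · exact mul_assoc a.right b.right c.right

/-- `(S ⋊ G)^1`: the semidirect product with a new identity element adjoined. -/
abbrev SemidirectWithOne (S G : Type*) [SemilatticeInf S] [Group G] (φ : G →* (S ≃o S)) :
    Type _ :=
  WithOne (SemilatticeSemidirect S G φ)

/-! ### Group congruences and inverse monoids in general -/

section InverseMonoids

/-! For `g ≠ 1` the elements `(s, g)` form a single `σ`-class, and a greatest element there would
give a greatest element of `S`. A cover must split such classes so that each piece has only finitely
many constraints from `S`.

Let `R = ZMod n` be non-trivial with additive group in the variety. Replace `G` by a subset of `R[G
× S] ⋊ G`: pairs `(f, g)` where `f` pushes forward to `g - 1` in `R[G]`. The cover `chainCover`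
consists of `(m, (f, g))` with `m` over `g` and below every label in the support of `f`. The
identity `gh - 1 = (g - 1) + g(h - 1)` gives closure under products.

The `σ`-classes are the fibres over `(f, g)`. If `f ≠ 0`, the meet of the finitely many labels gives
the maximum; if `f = 0`, then `g - 1 = 0`, so `g = 1` and the maximum is the identity
(`exists_greatest_chainCover`). The kernel over `M/σ` has `g = 1`, so it embeds in a power of the
additive group of `R` (`mem_ker_map_coverMap`). -/

theorem NaturalLE.leastGroupCon_rel {M : Type*} [Monoid M] {a b : M} (h : NaturalLE a b) :
    leastGroupCon M a b := by
  obtain ⟨e, he, rfl⟩ := h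
  simpa using (leastGroupCon M).mul (leastGroupCon_rel_one he) ((leastGroupCon M).refl b)

/-- A homomorphism to a group kills idempotents, so its kernel is a group congruence and contains
`σ`. -/
theorem eq_of_leastGroupCon_rel {M H : Type*} [Monoid M] [IsInverseMonoid M] [Group H]
    (p : M →* H) {a b : M} (h : leastGroupCon M a b) : p a = p b := by
  have hp : IsGroupCon (Con.ker p) := isGroupCon_of_rel_one fun e he => by
    rw [Con.ker_rel, map_one]
    exact IsIdempotentElem.iff_eq_one.1 (he.map p)
  exact (Con.ker_rel p).1 (sInf_le (a := Con.ker p) hp h)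

/-- A submonoid of the product of an inverse monoid and a group which contains an inverse of each
of its elements is an inverse monoid. -/
theorem isInverseMonoid_submonoid_prod {M H : Type*} [Monoid M] [hM : IsInverseMonoid M] [Group H]
    (F : Submonoid (M × H))
    (hF : ∀ a ∈ F, ∃ b : M, (a.1 = a.1 * b * a.1 ∧ b = b * a.1 * b) ∧ (b, a.2⁻¹) ∈ F) :
    IsInverseMonoid F := by
  refine ⟨fun a => ?_⟩
  obtain ⟨b, ⟨h1, h2⟩, hb⟩ := hF a a.2
  refine ⟨⟨(b, a.1.2⁻¹), hb⟩, ⟨?_, ?_⟩, ?_⟩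
  · exact Subtype.ext (Prod.ext h1 (by simp))
  · exact Subtype.ext (Prod.ext h2 (by simp))
  · rintro ⟨⟨c, k⟩, hc⟩ ⟨h3, h4⟩
    have h5 := congrArg (fun x : F => x.1.1) h3
    have h6 := congrArg (fun x : F => x.1.1) h4
    have h7 := congrArg (fun x : F => x.1.2) h3
    refine Subtype.ext (Prod.ext ((hM.existsUnique_inverse a.1.1).unique ⟨h5, h6⟩ ⟨h1, h2⟩) ?_)
    change a.1.2 = a.1.2 * k * a.1.2 at h7
    rw [eq_comm, mul_eq_right] at h7
    exact eq_inv_of_mul_eq_one_right h7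

end InverseMonoids

/-! ### Cyclic groups in a non-trivial variety -/

namespace GroupVariety

/-- A group that is separated by homomorphisms to a member of a variety belongs to the variety. -/
theorem Mem.of_separating {U : GroupVariety} {K H ι : Type*} [Group K] [Group H] (hH : U.Mem H)
    (q : ι → K →* H) (hq : ∀ k : K, (∀ i, q i k = 1) → k = 1) : U.Mem K := by
  intro w hw v
  refine hq _ fun i => ?_
  have h : (q i).comp (FreeGroup.lift v) = FreeGroup.lift (q i ∘ v) := by
    ext; simp
  exact (DFunLike.congr_fun h w).trans (hH w hw _)

theorem IsNontrivial.exists_zmod_mem {U : GroupVariety} (hU : IsNontrivial.{w} U) :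
    ∃ n : ℕ, n ≠ 1 ∧ U.Mem (Multiplicative (ZMod n)) := by
  obtain ⟨H, _, hH, _⟩ := hU
  obtain ⟨a, ha⟩ := exists_ne (1 : H)
  -- The cyclic group generated by `a`; infinite order gives `n = 0`, where `ZMod 0` is the
  -- integers.
  refine ⟨orderOf a, by rwa [Ne, orderOf_eq_one_iff], ?_⟩
  let f : ZMod (orderOf a) →+ Additive H :=
    ZMod.lift (orderOf a) ⟨zmultiplesHom (Additive H) (Additive.ofMul a), by
      simp [← ofMul_pow, pow_orderOf_eq_one]⟩
  have hf : Function.Injective f := by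
    rw [ZMod.lift_injective]
    intro m hm
    rw [zmultiplesHom_apply, ← ofMul_zpow, ofMul_eq_zero] at hm
    exact (ZMod.intCast_zmod_eq_zero_iff_dvd _ _).2 (orderOf_dvd_iff_zpow_eq_one.2 hm)
  refine hH.of_separating (fun _ : Unit => AddMonoidHom.toMultiplicativeLeft f) fun k hk => ?_
  exact hf ((hk ()).trans (map_zero f).symm)

end GroupVariety

/-! ### Structure and order of the semidirect product -/

section Semidirect

variable {S G : Type*} [SemilatticeInf S] [Group G] (φ : G →* (S ≃o S))

namespace SemilatticeSemidirect

variable {φ}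

@[simp] theorem mul_left (a b : SemilatticeSemidirect S G φ) :
    (a * b).left = a.left ⊓ φ a.right b.left := rfl

@[simp] theorem mul_right (a b : SemilatticeSemidirect S G φ) :
    (a * b).right = a.right * b.right := rfl

@[simp] theorem apply_apply_inv (g : G) (s : S) : φ g (φ g⁻¹ s) = s := by
  rw [← RelIso.mul_apply, ← map_mul]; simp

@[simp] theorem apply_inv_apply (g : G) (s : S) : φ g⁻¹ (φ g s) = s := by
  rw [← RelIso.mul_apply, ← map_mul]; simp

/-- The inverse of `(s, g)` in `S ⋊ G`. -/
def inverse (a : SemilatticeSemidirect S G φ) : SemilatticeSemidirect S G φ :=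
  ⟨φ a.right⁻¹ a.left, a.right⁻¹⟩

theorem mul_inverse_mul (a : SemilatticeSemidirect S G φ) : a * a.inverse * a = a := by
  ext <;> simp [inverse]

theorem inverse_mul_inverse (a : SemilatticeSemidirect S G φ) :
    a.inverse * a * a.inverse = a.inverse := by
  ext <;> simp [inverse]

/-- The two equations bound the left components by each other's translates, in opposite directions.
-/
theorem eq_inverse {a b : SemilatticeSemidirect S G φ} (h1 : a = a * b * a)
    (h2 : b = b * a * b) : b = a.inverse := by
  have hg : b.right = a.right⁻¹ := by
    have h := congrArg SemilatticeSemidirect.right h1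
    simp only [mul_right] at h
    rw [eq_comm, mul_eq_right] at h
    exact eq_inv_of_mul_eq_one_right h
  have l1 : a.left ≤ φ a.right b.left := by
    have h := congrArg SemilatticeSemidirect.left h1
    simp only [mul_left] at h
    rw [h]
    exact inf_le_left.trans inf_le_right
  have l2 : b.left ≤ φ a.right⁻¹ a.left := by
    have h := congrArg SemilatticeSemidirect.left h2
    simp only [mul_left, hg] at h
    rw [h]
    exact inf_le_left.trans inf_le_right
  refine SemilatticeSemidirect.ext (le_antisymm l2 ?_) hg
  simpa [inverse] using (φ a.right⁻¹).monotone l1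

theorem isIdempotentElem_iff {a : SemilatticeSemidirect S G φ} :
    IsIdempotentElem a ↔ a.right = 1 := by
  refine ⟨fun h => ?_, fun h => ?_⟩
  · simpa using congrArg SemilatticeSemidirect.right h.eq
  · ext <;> simp [h]

/-- The projection `S ⋊ G → G`. -/
def rightHom : SemilatticeSemidirect S G φ →ₙ* G := ⟨right, mul_right⟩

end SemilatticeSemidirect

namespace SemidirectWithOne

open SemilatticeSemidirect

instance instIsInverseMonoid : IsInverseMonoid (SemidirectWithOne S G φ) := by
  refine ⟨fun a => ?_⟩
  cases a using WithOne.recOneCoe with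
  | one => exact ⟨1, by simp, fun b hb => by simpa using hb.1.symm⟩
  | coe a =>
    refine ⟨(a.inverse : SemidirectWithOne S G φ), ⟨?_, ?_⟩, fun b hb => ?_⟩
    · rw [← WithOne.coe_mul, ← WithOne.coe_mul, mul_inverse_mul]
    · rw [← WithOne.coe_mul, ← WithOne.coe_mul, inverse_mul_inverse]
    · cases b using WithOne.recOneCoe with
      | one =>
        have h := hb.2
        rw [one_mul, mul_one] at h
        exact absurd h WithOne.one_ne_coe
      | coe b =>
        obtain ⟨h1, h2⟩ := hb
        rw [← WithOne.coe_mul, ← WithOne.coe_mul, WithOne.coe_inj] at h1 h2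
        rw [eq_inverse h1 h2]

variable {φ}

/-- The projection `(S ⋊ G)^1 → G`. -/
def toGroup : SemidirectWithOne S G φ →* G := WithOne.lift rightHom

@[simp] theorem toGroup_coe (a : SemilatticeSemidirect S G φ) :
    toGroup (a : SemidirectWithOne S G φ) = a.right := rfl

theorem isIdempotentElem_iff {a : SemidirectWithOne S G φ} :
    IsIdempotentElem a ↔ toGroup a = 1 := by
  cases a using WithOne.recOneCoe with
  | one => exact iff_of_true IsIdempotentElem.one (map_one _)
  | coe a =>
    rw [toGroup_coe, ← SemilatticeSemidirect.isIdempotentElem_iff, IsIdempotentElem,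
      ← WithOne.coe_mul, WithOne.coe_inj, IsIdempotentElem]

theorem NaturalLE.toGroup_eq {a b : SemidirectWithOne S G φ} (h : NaturalLE a b) :
    toGroup a = toGroup b := by
  obtain ⟨e, he, rfl⟩ := h
  rw [map_mul, isIdempotentElem_iff.1 he, one_mul]

theorem naturalLE_coe_coe {a b : SemilatticeSemidirect S G φ} :
    NaturalLE (a : SemidirectWithOne S G φ) b ↔ a.left ≤ b.left ∧ a.right = b.right := by
  constructor
  · intro h
    refine ⟨?_, NaturalLE.toGroup_eq h⟩
    obtain ⟨e, he, h⟩ := h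
    cases e using WithOne.recOneCoe with
    | one =>
      rw [one_mul, WithOne.coe_inj] at h
      rw [h]
    | coe e =>
      rw [isIdempotentElem_iff, toGroup_coe] at he
      rw [← WithOne.coe_mul, WithOne.coe_inj] at h
      simp [h, he]
  · rintro ⟨h1, h2⟩
    refine ⟨((⟨a.left, 1⟩ : SemilatticeSemidirect S G φ) : SemidirectWithOne S G φ),
      isIdempotentElem_iff.2 rfl, ?_⟩
    rw [← WithOne.coe_mul, WithOne.coe_inj]
    ext <;> simp [h1, h2]

theorem eq_one_of_one_naturalLE {a : SemidirectWithOne S G φ} (h : NaturalLE 1 a) : a = 1 := by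
  obtain ⟨e, -, h⟩ := h
  cases a using WithOne.recOneCoe with
  | one => rfl
  | coe a =>
    cases e using WithOne.recOneCoe with
    | one => rw [h, one_mul]
    | coe e => exact absurd h WithOne.one_ne_coe

theorem isFiniteAbove (hS : ∀ s : S, {t : S | s < t}.Finite) :
    IsFiniteAbove (SemidirectWithOne S G φ) := by
  intro m
  cases m using WithOne.recOneCoe with
  | one => exact (Set.finite_singleton 1).subset fun n hn => eq_one_of_one_naturalLE hn
  | coe a =>
    have hfin : (insert a.left {t : S | a.left < t}).Finite := (hS a.left).insert _
    refine ((hfin.image fun t => ((⟨t, a.right⟩ : SemilatticeSemidirect S G φ) :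
      SemidirectWithOne S G φ)).insert 1).subset fun n hn => ?_
    cases n using WithOne.recOneCoe with
    | one => exact Set.mem_insert _ _
    | coe b =>
      obtain ⟨h1, h2⟩ := naturalLE_coe_coe.1 hn
      refine Or.inr ⟨b.left, h1.eq_or_lt.imp Eq.symm id, ?_⟩
      rw [h2]

theorem isEUnitary : IsEUnitary (SemidirectWithOne S G φ) := fun e m he h => by
  rw [isIdempotentElem_iff] at he ⊢
  rw [← NaturalLE.toGroup_eq h, he]

/-- Each `(s, g)` shares the lower bound `(s ⊓ s₀, g)` with `(s₀, g)`, so all lie in one `σ`-class;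
choosing `g ≠ 1` keeps the adjoined identity out of it. -/
theorem not_isFInverse [Nonempty S] [Nontrivial G] (hS : ¬ ∃ t : S, ∀ s : S, s ≤ t) :
    ¬ IsFInverse (SemidirectWithOne S G φ) := by
  rintro ⟨-, h⟩
  obtain ⟨g, hg⟩ := exists_ne (1 : G)
  obtain ⟨s₀⟩ := ‹Nonempty S›
  let elt (s : S) : SemidirectWithOne S G φ :=
    ((⟨s, g⟩ : SemilatticeSemidirect S G φ) : SemidirectWithOne S G φ)
  obtain ⟨m, hm, hmax⟩ := h (elt s₀)
  have hmg : toGroup m = g := eq_of_leastGroupCon_rel toGroup hm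
  cases m using WithOne.recOneCoe with
  | one => exact hg (hmg.symm.trans (map_one _))
  | coe t =>
    refine hS ⟨t.left, fun s => ?_⟩
    have h1 : NaturalLE (elt (s ⊓ s₀)) (elt s) := naturalLE_coe_coe.2 ⟨inf_le_left, rfl⟩
    have h2 : NaturalLE (elt (s ⊓ s₀)) (elt s₀) := naturalLE_coe_coe.2 ⟨inf_le_right, rfl⟩
    exact (naturalLE_coe_coe.1 (hmax (elt s) ((leastGroupCon _).trans
      ((leastGroupCon _).symm h1.leastGroupCon_rel) h2.leastGroupCon_rel))).1

/-! ### The cover -/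

variable (φ) (R : Type*) [Ring R]

/-- The diagonal action of `G` on the finitely supported functions `G × S → R`. -/
noncomputable def chainAction : G →* MulAut (Multiplicative (G × S →₀ R)) where
  toFun g := AddEquiv.toMultiplicative
    (Finsupp.domCongr ((Equiv.mulLeft g).prodCongr (φ g).toEquiv))
  map_one' := by
    refine MulEquiv.ext fun f => Multiplicative.toAdd.injective (Finsupp.ext fun ⟨x, t⟩ => ?_)
    simp [Finsupp.domCongr_apply, Finsupp.equivMapDomain_apply]
    rfl
  map_mul' g h := by
    refine MulEquiv.ext fun f => Multiplicative.toAdd.injective (Finsupp.ext fun ⟨x, t⟩ => ?_)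
    simp [Finsupp.domCongr_apply, Finsupp.equivMapDomain_apply]
    rfl

variable {R}

theorem chainAction_apply (g : G) (f : Multiplicative (G × S →₀ R)) (x : G) (t : S) :
    (chainAction φ R g f).toAdd (x, t) = f.toAdd (g⁻¹ * x, φ g⁻¹ t) := by
  rw [map_inv]; rfl

theorem mapDomain_fst_chainAction (g : G) (f : Multiplicative (G × S →₀ R)) :
    (chainAction φ R g f).toAdd.mapDomain Prod.fst =
      (f.toAdd.mapDomain Prod.fst).mapDomain (g * ·) := by
  change (Finsupp.equivMapDomain _ f.toAdd).mapDomain Prod.fst = _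
  rw [Finsupp.equivMapDomain_eq_mapDomain, ← Finsupp.mapDomain_comp, ← Finsupp.mapDomain_comp]
  rfl

variable (R)

/-- The extension of `G` by labelled chains, from which the group image of the cover is taken. -/
abbrev ChainGroup : Type _ := Multiplicative (G × S →₀ R) ⋊[chainAction φ R] G

/-- The `F`-inverse cover of `(S ⋊ G)^1`: pairs `(m, (f, g))` where `m` lies over `g`, the chain
`f` has boundary `g - 1`, the labels in the support of `f` are above `m`, and `m = 1` only if
`f = 0`. -/
noncomputable def chainCover : Submonoid (SemidirectWithOne S G φ × ChainGroup φ R) where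
  carrier := {a | toGroup a.1 = a.2.right ∧
    a.2.left.toAdd.mapDomain Prod.fst = Finsupp.single a.2.right 1 - Finsupp.single 1 1 ∧
    (a.1 = 1 → a.2.left = 1) ∧
    ∀ b : SemilatticeSemidirect S G φ, a.1 = b → ∀ x t, a.2.left.toAdd (x, t) ≠ 0 → b.left ≤ t}
  one_mem' := by
    refine ⟨map_one _, ?_, fun _ => rfl, fun b hb x t h => absurd hb WithOne.one_ne_coe⟩
    simp
  mul_mem' := by
    rintro ⟨m, h⟩ ⟨n, k⟩ ⟨a1, a2, a3, a4⟩ ⟨b1, b2, b3, b4⟩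
    simp only at a1 a2 a3 a4 b1 b2 b3 b4
    refine ⟨?_, ?_, ?_, ?_⟩
    · simp [a1, b1]
    · simp only [Prod.mk_mul_mk, SemidirectProduct.mul_left, SemidirectProduct.mul_right, toAdd_mul,
        Finsupp.mapDomain_add, mapDomain_fst_chainAction, a2, b2]
      rw [Finsupp.mapDomain_sub, Finsupp.mapDomain_single, Finsupp.mapDomain_single, mul_one]
      abel
    · intro h1
      cases m using WithOne.recOneCoe with
      | one =>
        have h2 : n = 1 := by simpa using h1
        simp [a3 rfl, b3 h2]
      | coe a =>
        cases n using WithOne.recOneCoe with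
        | one => exact absurd h1 (by simp)
        | coe b => exact absurd h1 WithOne.coe_ne_one
    · intro c hc x t hx
      simp only [Prod.mk_mul_mk, SemidirectProduct.mul_left, toAdd_mul, Finsupp.add_apply,
        chainAction_apply] at hx hc
      cases m using WithOne.recOneCoe with
      | one =>
        have hr : h.right = 1 := by rw [← a1, map_one]
        rw [a3 rfl, hr] at hx
        exact b4 c (by simpa using hc) x t (by simpa using hx)
      | coe a =>
        cases n using WithOne.recOneCoe with
        | one =>
          rw [b3 rfl] at hx
          exact a4 c (by simpa using hc) x t (by simpa using hx)
        | coe b =>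
          rw [← WithOne.coe_mul, WithOne.coe_inj] at hc
          rw [← hc, mul_left]
          rw [toGroup_coe] at a1
          -- A label of the product's chain comes from the first chain or from the translate of the
          -- second.
          by_cases hz : h.left.toAdd (x, t) = 0
          · rw [hz, zero_add] at hx
            have := (φ a.right).monotone (b4 b rfl _ _ hx)
            rw [← a1, apply_apply_inv] at this
            exact inf_le_right.trans this
          · exact inf_le_left.trans (a4 a rfl x t hz)

variable {φ R}

instance chainCover_isInverseMonoid : IsInverseMonoid (chainCover φ R) := by
  refine isInverseMonoid_submonoid_prod _ ?_
  rintro ⟨m, h⟩ ⟨a1, a2, a3, a4⟩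
  simp only at a1 a2 a3 a4
  have hbd : (h⁻¹).left.toAdd.mapDomain Prod.fst =
      Finsupp.single (h⁻¹).right 1 - Finsupp.single (1 : G) (1 : R) := by
    rw [SemidirectProduct.inv_left, mapDomain_fst_chainAction, toAdd_inv,
      ← Finsupp.mapDomain.addMonoidHom_apply Prod.fst, map_neg,
      Finsupp.mapDomain.addMonoidHom_apply, a2,
      neg_sub, Finsupp.mapDomain_sub, Finsupp.mapDomain_single, Finsupp.mapDomain_single]
    simp
  cases m using WithOne.recOneCoe with
  | one =>
    refine ⟨1, by simp, ?_, hbd, fun _ => ?_, fun b hb => absurd hb WithOne.one_ne_coe⟩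
    · simp [← a1]
    · simp [a3 rfl]
  | coe a =>
    rw [toGroup_coe] at a1
    refine ⟨(a.inverse : SemidirectWithOne S G φ), ⟨?_, ?_⟩, ?_, hbd,
      fun hb => absurd hb WithOne.coe_ne_one, fun b hb x t hx => ?_⟩
    · rw [← WithOne.coe_mul, ← WithOne.coe_mul, mul_inverse_mul]
    · rw [← WithOne.coe_mul, ← WithOne.coe_mul, inverse_mul_inverse]
    · simp [← a1, inverse]
    · rw [WithOne.coe_inj] at hb
      subst hb
      simp only [SemidirectProduct.inv_left, chainAction_apply, toAdd_inv, Finsupp.neg_apply,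
        neg_ne_zero, inv_inv] at hx
      have := (φ a.right⁻¹).monotone (a4 a rfl _ _ hx)
      rwa [← a1, apply_inv_apply] at this

variable (φ R)

/-- The projection of the cover onto `(S ⋊ G)^1`. -/
noncomputable def coverMap : chainCover φ R →* SemidirectWithOne S G φ :=
  (MonoidHom.fst _ _).comp (chainCover φ R).subtype

/-- The projection of the cover to the group of chains. -/
noncomputable def coverToChainGroup : chainCover φ R →* ChainGroup φ R :=
  (MonoidHom.snd _ _).comp (chainCover φ R).subtype

variable {φ R}

/-- An idempotent `e` lifts to `(e, 1)`, whose zero chain imposes no label condition. -/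
theorem naturalLE_chainCover {a b : chainCover φ R} (h : NaturalLE a.1.1 b.1.1)
    (h' : a.1.2 = b.1.2) : NaturalLE a b := by
  obtain ⟨e, he, h⟩ := h
  refine ⟨⟨(e, 1), (isIdempotentElem_iff.1 he), by simp, fun _ => rfl, fun b _ x t hx => ?_⟩,
    Subtype.ext (Prod.ext he.eq (one_mul 1)), Subtype.ext (Prod.ext h ?_)⟩
  · simp at hx
  · exact h'.trans (one_mul _).symm

/-- The zero chain has boundary zero, which forces `g - 1 = 0` in `R[G]`. -/
theorem right_eq_one_of_left_eq_one [Nontrivial R] {a : chainCover φ R} (h : a.1.2.left = 1) :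
    a.1.2.right = 1 := by
  have h2 := a.2.2.1
  rw [h, toAdd_one, Finsupp.mapDomain_zero, eq_comm, sub_eq_zero] at h2
  exact Finsupp.single_left_injective one_ne_zero h2

theorem exists_greatest_chainCover [Nontrivial R] (a : chainCover φ R) :
    ∃ m : chainCover φ R, coverToChainGroup φ R m = coverToChainGroup φ R a ∧
      ∀ b, coverToChainGroup φ R b = coverToChainGroup φ R a → NaturalLE b m := by
  by_cases h : a.1.2.left = 1
  · have h1 : coverToChainGroup φ R a = 1 :=
      SemidirectProduct.ext h (right_eq_one_of_left_eq_one h)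
    refine ⟨1, by rw [h1, map_one], fun b hb => naturalLE_chainCover ⟨b.1.1, ?_, (mul_one _).symm⟩
      (hb.trans h1)⟩
    rw [isIdempotentElem_iff, b.2.1]
    exact congrArg SemidirectProduct.right (hb.trans h1)
  · have hne : (a.1.2.left.toAdd).support.Nonempty :=
      Finsupp.support_nonempty_iff.2 h
    let c : SemilatticeSemidirect S G φ :=
      ⟨(a.1.2.left.toAdd).support.inf' hne Prod.snd, a.1.2.right⟩
    refine ⟨⟨(c, a.1.2), rfl, a.2.2.1, fun hc => absurd hc WithOne.coe_ne_one,
      fun b hb x t hx => ?_⟩, rfl, ?_⟩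
    · rw [WithOne.coe_inj] at hb
      rw [← hb]
      exact Finset.inf'_le Prod.snd (Finsupp.mem_support_iff.2 hx)
    · rintro ⟨⟨m, k⟩, hb⟩ hk
      change k = a.1.2 at hk
      subst hk
      refine naturalLE_chainCover ?_ rfl
      obtain ⟨b1, -, b3, b4⟩ := hb
      cases m using WithOne.recOneCoe with
      | one => exact absurd (b3 rfl) h
      | coe b =>
        refine naturalLE_coe_coe.2 ⟨Finset.le_inf' hne _ ?_, b1⟩
        rintro ⟨x, t⟩ hx
        exact b4 b rfl x t (Finsupp.mem_support_iff.1 hx)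

/-- Elements of one fibre lie below a common element, so `σ` identifies them. -/
theorem leastGroupCon_chainCover [Nontrivial R] {a b : chainCover φ R} :
    leastGroupCon _ a b ↔ coverToChainGroup φ R a = coverToChainGroup φ R b := by
  refine ⟨eq_of_leastGroupCon_rel _, fun h => ?_⟩
  obtain ⟨m, -, hm⟩ := exists_greatest_chainCover b
  exact (leastGroupCon _).trans (hm a h).leastGroupCon_rel
    ((leastGroupCon _).symm (hm b rfl).leastGroupCon_rel)

theorem isFInverse_chainCover [Nontrivial R] : IsFInverse (chainCover φ R) := by
  refine ⟨inferInstance, fun a => ?_⟩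
  simpa only [leastGroupCon_chainCover] using exists_greatest_chainCover a

/-! ### The covering map and its kernel on group images -/

theorem coverMap_surjective : Function.Surjective (coverMap φ R) := by
  intro m
  by_cases hm : toGroup m = 1
  · exact ⟨⟨(m, 1), hm, by simp, fun _ => rfl, fun b _ x t hx => by simp at hx⟩, rfl⟩
  · cases m using WithOne.recOneCoe with
    | one => exact absurd (map_one _) hm
    | coe a =>
      -- The chain from `1` to `g` with both ends labelled by `s` lifts `(s, g)`.
      refine ⟨⟨(a, ⟨Multiplicative.ofAdd
        (Finsupp.single (a.right, a.left) 1 - Finsupp.single (1, a.left) 1), a.right⟩), rfl, ?_,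
        fun h => absurd h WithOne.coe_ne_one, fun b hb x t hx => ?_⟩, rfl⟩
      · simp only [toAdd_ofAdd]
        rw [Finsupp.mapDomain_sub, Finsupp.mapDomain_single, Finsupp.mapDomain_single]
      · rw [WithOne.coe_inj] at hb
        subst hb
        by_contra hle
        have hne : a.left ≠ t := fun h => hle h.le
        simp [hne] at hx

/-- The group component of an idempotent is trivial, leaving only the component in `M`. -/
theorem coverMap_injOn : Set.InjOn (coverMap φ R) {e | IsIdempotentElem e} := by
  intro a ha b hb h
  have h1 := IsIdempotentElem.iff_eq_one.1 (IsIdempotentElem.map ha (coverToChainGroup φ R))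
  have h2 := IsIdempotentElem.iff_eq_one.1 (IsIdempotentElem.map hb (coverToChainGroup φ R))
  exact Subtype.ext (Prod.ext h (h1.trans h2.symm))

variable (φ R)

/-- The homomorphism from the group image of the cover to the group of chains. -/
noncomputable def groupImageToChainGroup : GroupImage (chainCover φ R) →* ChainGroup φ R :=
  (leastGroupCon _).lift (coverToChainGroup φ R) fun _ _ h => eq_of_leastGroupCon_rel _ h

variable {φ R}

theorem groupImageToChainGroup_injective [Nontrivial R] :
    Function.Injective (groupImageToChainGroup φ R) := by
  intro x y h
  induction x, y using Con.induction_on₂ with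
  | H a b => exact (leastGroupCon _).eq.2 (leastGroupCon_chainCover.2 h)

theorem groupImageToChainGroup_right {x : GroupImage (chainCover φ R)}
    (hx : GroupImage.map (coverMap φ R) x = 1) : (groupImageToChainGroup φ R x).right = 1 := by
  induction x using Con.induction_on with
  | H a =>
    have h : leastGroupCon _ a.1.1 1 := (leastGroupCon _).eq.1 hx
    have h2 := eq_of_leastGroupCon_rel toGroup h
    rw [map_one, a.2.1] at h2
    exact h2

theorem mem_ker_map_coverMap [Nontrivial R] {U : GroupVariety}
    (hU : U.Mem (Multiplicative R)) : U.Mem (GroupImage.map (coverMap φ R)).ker := by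
  let q (i : G × S) : (GroupImage.map (coverMap φ R)).ker →* Multiplicative R :=
    { toFun := fun x => Multiplicative.ofAdd ((groupImageToChainGroup φ R x.1).left.toAdd i)
      map_one' := by
        rw [OneMemClass.coe_one, map_one]
        rfl
      map_mul' := fun x y => by
        -- On the kernel the `G`-component is `1`, so the twisting disappears and each coordinate is
        -- additive.
        have hx := groupImageToChainGroup_right x.2
        rw [Subgroup.coe_mul, map_mul, SemidirectProduct.mul_left, hx, map_one]
        rfl }
  refine hU.of_separating q fun k hk => Subtype.ext (groupImageToChainGroup_injective ?_)
  rw [OneMemClass.coe_one, map_one]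
  refine SemidirectProduct.ext ?_ (groupImageToChainGroup_right k.2)
  exact Multiplicative.toAdd.injective (Finsupp.ext fun i => hk i)

end SemidirectWithOne

end Semidirect

theorem mainTheorem9 (S : Type u) (G : Type v) [SemilatticeInf S] [Nonempty S] [Group G]
    (φ : G →* (S ≃o S))
    (hS_top : ¬ ∃ t : S, ∀ s : S, s ≤ t)
    (hS_fin : ∀ s : S, {t : S | s < t}.Finite) :
    IsInverseMonoid (SemidirectWithOne S G φ) ∧
    IsFiniteAbove (SemidirectWithOne S G φ) ∧
    IsEUnitary (SemidirectWithOne S G φ) ∧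
    (Nontrivial G → ¬ IsFInverse (SemidirectWithOne S G φ)) ∧
    ∀ U : GroupVariety, GroupVariety.IsNontrivial.{w} U →
      HasFInverseCoverVia (SemidirectWithOne S G φ) U := by
  refine ⟨inferInstance, SemidirectWithOne.isFiniteAbove hS_fin, SemidirectWithOne.isEUnitary,
    fun _ => SemidirectWithOne.not_isFInverse hS_top, fun U hU => ?_⟩
  obtain ⟨n, hn, hmem⟩ := hU.exists_zmod_mem
  have : Nontrivial (ZMod n) := ZMod.nontrivial_iff.2 hn
  exact ⟨SemidirectWithOne.chainCover φ (ZMod n), inferInstance, inferInstance,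
    SemidirectWithOne.coverMap φ (ZMod n), SemidirectWithOne.isFInverse_chainCover,
    SemidirectWithOne.coverMap_surjective, SemidirectWithOne.coverMap_injOn,
    SemidirectWithOne.mem_ker_map_coverMap hmem⟩
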